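/- Let $M$ be a three-dimensional smooth manifold (Hausdorff, second countable) with a contact sub-Riemannian structure $(\mathcal D,g)$: $\mathcal D\subset TM$ is a rank-two distribution that is locally the kernel of a smooth one-form $\omega$ with $\omega\wedge d\omega\neq 0$ everywhere, and $g$ is a smooth metric on $\mathcal D$. Let $\mu$ be a smooth measure on $M$, i.e. $\mu(B)=\int_B dV_\mu$ for a smooth nowhere vanishing $3$-form $dV_\mu$ (with $M$ oriented by $dV_\mu$). For a smooth function $\Phi:M\to\mathbb R$ let the horizontal gradient $\nabla_H\Phi$ be the unique vector field tangent to $\mathcal D$ with $g(\nabla_H\Phi,v)=d\Phi(v)$ for all $v\in\mathcal D$, and let $\|\nabla_H\Phi\|=g(\nabla_H\Phi,\nabla_H\Phi)^{1/2}$. Assume that $\|\nabla_H\Phi\|\neq 0$ at every point of $M$. Then every non-empty level set $\Phi^{-1}(t)$ is a smooth surface, and we let $$dA_t=\iota\!\left(\frac{\nabla_H\Phi}{\|\nabla_H\Phi\|}\right)dV_\mu\Big|_{T\Phi^{-1}(t)}$$ be its induced sub-Riemannian area form ($\Phi^{-1}(t)$ being oriented so that $dA_t>0$). Let $f:M\to[0,\infty)$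 be ($\mu$-)measurable. Then, for almost every $t\in\mathbb R$, $f|_{\Phi^{-1}(t)}$ is measurable with respect to $dA_t$, the function $t\mapsto\int_{\Phi^{-1}(t)}f\,dA_t\in[0,\infty]$ is Lebesgue measurable, and $$\int_M f\,\|\nabla_H\Phi\|\,d\mu=\int_{\mathbb R}\left(\int_{\Phi^{-1}(t)} f|_{\Phi^{-1}(t)}\,dA_t\right)dt$$ as an equality in $[0,\infty]$. -/

import Mathlib

open MeasureTheory
open scoped Manifold ContDiff ENNReal

noncomputable section

namespace SubRiem

/-- The model space `ℝ³`. -/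
abbrev E3 : Type := EuclideanSpace ℝ (Fin 3)

/-! ### Differential forms on a three-dimensional manifold -/

/-- A (not necessarily smooth) differential `k`-form on `M`. -/
abbrev DiffForm (M : Type*) [TopologicalSpace M] [ChartedSpace E3 M] (k : ℕ) : Type _ :=
  ∀ p : M, (TangentSpace (𝓡 3) p) [⋀^Fin k]→L[ℝ] ℝ

section Forms

variable {M : Type*} [TopologicalSpace M] [ChartedSpace E3 M]

/-- The coordinate expression of the form `α` in the chart around `x`: the pull-back of `α` by the
inverse of that chart. It is meaningful on the target of the chart. -/
def DiffForm.inChart {k : ℕ} (α : DiffForm M k) (x : M) (y : E3) : E3 [⋀^Fin k]→L[ℝ] ℝ :=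
  (α ((extChartAt (𝓡 3) x).symm y)).compContinuousLinearMap
    (mfderiv 𝓘(ℝ, E3) (𝓡 3) (extChartAt (𝓡 3) x).symm y)

/-- `α` is a smooth form on the (open) set `U`: its coordinate expressions are smooth. -/
def DiffForm.IsSmoothOn {k : ℕ} (α : DiffForm M k) (U : Set M) : Prop :=
  ∀ x : M, ContDiffOn ℝ ∞ (α.inChart x)
    ((extChartAt (𝓡 3) x).target ∩ (extChartAt (𝓡 3) x).symm ⁻¹' U)

/-- The exterior derivative of `α`, computed at `p` in the chart around `p`. -/
def DiffForm.d {k : ℕ} (α : DiffForm M k) : DiffForm M (k + 1) := fun p =>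
  (extDeriv (α.inChart p) (extChartAt (𝓡 3) p p)).compContinuousLinearMap
    (mfderiv (𝓡 3) 𝓘(ℝ, E3) (extChartAt (𝓡 3) p) p)

/-- The value of `η ∧ β` at `p` on `(u, v, w)`, for a `1`-form `η` and a `2`-form `β`. -/
def DiffForm.wedge (η : DiffForm M 1) (β : DiffForm M 2) (p : M)
    (u v w : TangentSpace (𝓡 3) p) : ℝ :=
  η p ![u] * β p ![v, w] - η p ![v] * β p ![u, w] + η p ![w] * β p ![u, v]

/-- The interior product `ι_X α`, with `ι_X α (v₁, …, v_k) = α (X, v₁, …, v_k)`. -/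
def DiffForm.interior {k : ℕ} (X : ∀ p : M, TangentSpace (𝓡 3) p) (α : DiffForm M (k + 1)) :
    DiffForm M k := fun p =>
  ContinuousAlternatingMap.curryLeft (E := E3) (α p) (X p)

/-- `X` is a smooth vector field on `U`. -/
def IsSmoothVectorFieldOn [IsManifold (𝓡 3) ∞ M] (X : ∀ p : M, TangentSpace (𝓡 3) p) (U : Set M) : Prop :=
  ContMDiffOn (𝓡 3) (𝓡 3).tangent ∞ (fun q => (⟨q, X q⟩ : TangentBundle (𝓡 3) M)) U

end Forms

/-! ### Contact sub-Riemannian structures -/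

/-- A contact sub-Riemannian structure `(D, g)` on the three-dimensional manifold `M`: `D` is,
locally, the kernel of a smooth one-form `η` with `η ∧ dη ≠ 0` at every point (a global contact
form is allowed but not required), and `g` is a smooth metric on `D`. -/
structure ContactStructure (M : Type*) [TopologicalSpace M] [ChartedSpace E3 M]
    [IsManifold (𝓡 3) ∞ M] where
  /-- the distribution -/
  D : ∀ p : M, Submodule ℝ (TangentSpace (𝓡 3) p)
  contact : ∀ p : M, ∃ U : Set M, IsOpen U ∧ p ∈ U ∧ ∃ η : DiffForm M 1, η.IsSmoothOn U ∧
    ∀ q ∈ U, (∀ v : TangentSpace (𝓡 3) q, v ∈ D q ↔ η q ![v] = 0) ∧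
      ∃ u v w : TangentSpace (𝓡 3) q, η.wedge η.d q u v w ≠ 0
  /-- the metric on the distribution -/
  g : ∀ p : M, LinearMap.BilinForm ℝ (D p)
  g_symm : ∀ (p : M) (u v : D p), g p u v = g p v u
  g_pos : ∀ (p : M) (u : D p), u ≠ 0 → 0 < g p u u
  /-- `g` is smooth: `g(X, Y)` is smooth for all smooth local horizontal fields `X`, `Y`. -/
  g_smooth : ∀ U : Set M, IsOpen U → ∀ X Y : ∀ p : M, D p,
    IsSmoothVectorFieldOn (fun p => (X p : TangentSpace (𝓡 3) p)) U →
    IsSmoothVectorFieldOn (fun p => (Y p : TangentSpace (𝓡 3) p)) U →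
    ContMDiffOn (𝓡 3) 𝓘(ℝ, ℝ) ∞ (fun p => g p (X p) (Y p)) U

namespace ContactStructure

variable {M : Type*} [TopologicalSpace M] [ChartedSpace E3 M]
  [IsManifold (𝓡 3) ∞ M] (C : ContactStructure M)

theorem g_nondegenerate (p : M) : (C.g p).Nondegenerate := by
  have h : ∀ u : C.D p, (C.g p) u u = 0 → u = 0 := fun u hu => by
    by_contra hne
    exact absurd hu (C.g_pos p u hne).ne'
  exact ⟨fun u hu => h u (hu u), fun u hu => h u (hu u)⟩

instance (p : M) : FiniteDimensional ℝ (C.D p) :=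
  haveI : FiniteDimensional ℝ (TangentSpace (𝓡 3) p) :=
    inferInstanceAs (FiniteDimensional ℝ E3)
  inferInstance

/-- The differential of `Φ` at `p`, restricted to the distribution. -/
def horizontalDifferential (Φ : M → ℝ) (p : M) : Module.Dual ℝ (C.D p) :=
  (mfderiv (𝓡 3) 𝓘(ℝ, ℝ) Φ p).toLinearMap.domRestrict (C.D p)

/-- The horizontal gradient `∇_H Φ`: the horizontal vector field with
`g(∇_H Φ, v) = dΦ(v)` for every horizontal vector `v`. -/
def horizontalGradient (Φ : M → ℝ) (p : M) : C.D p :=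
  ((C.g p).toDual (C.g_nondegenerate p)).symm (C.horizontalDifferential Φ p)

theorem horizontalGradient_spec (Φ : M → ℝ) (p : M) (v : C.D p) :
    C.g p (C.horizontalGradient Φ p) v =
      mfderiv (𝓡 3) 𝓘(ℝ, ℝ) Φ p (v : TangentSpace (𝓡 3) p) :=
  LinearMap.BilinForm.apply_toDual_symm_apply (hB := C.g_nondegenerate p) _ _

/-- The norm of a horizontal vector. -/
def norm (p : M) (v : C.D p) : ℝ := Real.sqrt (C.g p v v)

/-- The horizontal unit normal `∇_H Φ / ‖∇_H Φ‖` to the level sets of `Φ`. -/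
def unitNormal (Φ : M → ℝ) (p : M) : TangentSpace (𝓡 3) p :=
  ((C.norm p (C.horizontalGradient Φ p))⁻¹ • C.horizontalGradient Φ p : C.D p)

end ContactStructure

/-! ### Integration of forms -/

section Integration

variable {M : Type*} [TopologicalSpace M] [ChartedSpace E3 M]

/-- A local parametrization of `S ⊆ M` by `k` parameters: a smooth injective immersion into `M`,
with values in `S`, of an open subset of `ℝᵏ`. (For a `k`-dimensional submanifold `S` the image is
relatively open in `S` and the map is a diffeomorphism onto it.) -/
structure Patch (k : ℕ) (S : Set M) where
  dom : Set (EuclideanSpace ℝ (Fin k))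
  isOpen_dom : IsOpen dom
  map : EuclideanSpace ℝ (Fin k) → M
  smooth : ContMDiffOn (𝓡 k) (𝓡 3) ∞ map dom
  injOn : Set.InjOn map dom
  immersion : ∀ u ∈ dom, Function.Injective (mfderiv (𝓡 k) (𝓡 3) map u)
  mapsTo : Set.MapsTo map dom S

/-- The density `|α(∂₁ψ, …, ∂ₖψ)|` of the `k`-form `α` in the parametrization `ψ`. -/
def Patch.density {k : ℕ} {S : Set M} (P : Patch k S) (α : DiffForm M k)
    (u : EuclideanSpace ℝ (Fin k)) : ℝ :=
  |α (P.map u) fun i => mfderiv (𝓡 k) (𝓡 3) P.map u (EuclideanSpace.single i (1 : ℝ))|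

variable [MeasurableSpace M]

/-- The measure `B ↦ ∫_{ψ⁻¹(B)} |α(∂₁ψ, …, ∂ₖψ)| du` carried by the image of a parametrization. -/
def Patch.measure {k : ℕ} {S : Set M} (P : Patch k S) (α : DiffForm M k) : Measure M :=
  Measure.map P.map
    ((volume.restrict P.dom).withDensity fun u => ENNReal.ofReal (P.density α u))

/-- The measure on `M` given by integrating the `k`-form `α` over the `k`-dimensional
submanifold `S`, oriented where `α|_S ≠ 0` by `α|_S` itself: the least measure that dominates the
measures carried by all local parametrizations of `S`. By the change of variables formula, those
are the restrictions of one and the same measure to the images of the parametrizations, and since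
countably many images cover `S`, the supremum is that measure, extended by zero outside `S`. -/
def formMeasure {k : ℕ} (α : DiffForm M k) (S : Set M) : Measure M :=
  ⨆ P : Patch k S, P.measure α

end Integration

/-- A smooth volume form on `M`. -/
structure VolumeForm (M : Type*) [TopologicalSpace M] [ChartedSpace E3 M] where
  form : DiffForm M 3
  smooth : form.IsSmoothOn Set.univ
  ne_zero : ∀ p : M, form p ≠ 0

section Measures

variable {M : Type*} [TopologicalSpace M] [ChartedSpace E3 M] [IsManifold (𝓡 3) ∞ M]
  [MeasurableSpace M]

/-- `μ` is the smooth measure with volume form `V`, that is, `μ(B) = ∫_B V`. -/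
def IsSmoothMeasure (μ : Measure M) (V : VolumeForm M) : Prop :=
  μ = formMeasure V.form Set.univ

/-- The sub-Riemannian area form `dA = ι(∇_H Φ / ‖∇_H Φ‖) V`. -/
def areaForm (C : ContactStructure M) (V : VolumeForm M) (Φ : M → ℝ) : DiffForm M 2 :=
  DiffForm.interior (C.unitNormal Φ) V.form

/-- The sub-Riemannian area `dA_t` on the surface `Φ⁻¹(t)`, as a measure on `M` carried by this
surface. -/
def areaMeasure (C : ContactStructure M) (V : VolumeForm M) (Φ : M → ℝ) (t : ℝ) : Measure M :=
  formMeasure (areaForm C V Φ) (Φ ⁻¹' {t})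

end Measures

end SubRiem

end

/-! The formula is Tonelli's theorem in coordinates adapted to `Φ`. Pairing the horizontal gradient
with the unit normal gives `dΦ(ν) = ‖∇_H Φ‖`, so `dΦ` vanishes nowhere, and near every point there
is a chart whose first coordinate is `Φ` (`exists_adaptedChart`). In it the level sets are the
planes `z₀ = t`. On such a plane `ι_ν V` is the zeroth component of `ν` times the coordinate density
of `V`, and this component is `dΦ(ν)`. Hence the area density is `‖∇_H Φ‖` times the volume density
(`AdaptedChart.density_areaForm`), and slicing `ℝ³ = ℝ × ℝ²` gives the formula in the chart
(`AdaptedChart.coarea`).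

Three further points are needed. `formMeasure` is a supremum over all parametrizations; by change of
variables a single one computes it on the open set that it covers (`formMeasure_restrict_eq`). The
weight `‖∇_H Φ‖` has to be measurable; it is continuous, by an explicit formula in a local
horizontal frame. Finally, countably many charts, cut into disjoint Borel pieces, give the Borel
case (`coarea_of_measurable`), and that case applied to a null set shows that almost every level set
meets it in zero area, which allows measurable `f`. -/

namespace SubRiem

open Set Topology

/-! ### Change of variables and the supremum defining `formMeasure` -/

section FormMeasure

variable {M : Type*} [TopologicalSpace M] [ChartedSpace E3 M]

/-- A top-degree alternating form on `ℝᵏ` composed with a linear endomorphism is multiplied by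
the determinant. -/
theorem alternating_map_single_det {k : ℕ}
    (β : EuclideanSpace ℝ (Fin k) [⋀^Fin k]→L[ℝ] ℝ)
    (L : EuclideanSpace ℝ (Fin k) →L[ℝ] EuclideanSpace ℝ (Fin k)) :
    β (fun i => L (EuclideanSpace.single i 1)) =
      L.det * β (fun i => EuclideanSpace.single i 1) := by
  let b := (EuclideanSpace.basisFun (Fin k) ℝ).toBasis
  have hb : ∀ i, b i = EuclideanSpace.single i (1 : ℝ) := fun i => by simp [b]
  have h := AlternatingMap.eq_smul_basis_det b β.toAlternatingMap
  have h1 := congrArg (fun γ => γ (L ∘ b)) h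
  have h2 := b.det_comp L.toLinearMap b
  rw [b.det_self, mul_one] at h2
  change b.det (L ∘ b) = _ at h2
  have hcomp : (fun i => L (EuclideanSpace.single i (1 : ℝ))) = L ∘ b := by
    ext1 i; simp [hb]
  have hbf : (fun i => EuclideanSpace.single i (1 : ℝ)) = b := by ext1 i; simp [hb]
  rw [hcomp, hbf]
  simp only [AlternatingMap.smul_apply, h2, smul_eq_mul] at h1
  rw [mul_comm]
  exact h1

/-- The chain rule factors the derivative of `P.map` through that of `τ`; the pulled-back top-degree
form then picks up the determinant. -/
theorem Patch.density_eq_det_mul {k : ℕ} {S : Set M} (P Q : Patch k S) (α : DiffForm M k)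
    {τ : EuclideanSpace ℝ (Fin k) → EuclideanSpace ℝ (Fin k)} {u : EuclideanSpace ℝ (Fin k)}
    (hu : τ u ∈ Q.dom) (hτ : DifferentiableAt ℝ τ u) (h : P.map =ᶠ[𝓝 u] Q.map ∘ τ) :
    P.density α u = |(fderiv ℝ τ u).det| * Q.density α (τ u) := by
  have hQ : MDifferentiableAt (𝓡 k) (𝓡 3) Q.map (τ u) :=
    ((Q.smooth _ hu).contMDiffAt (Q.isOpen_dom.mem_nhds hu)).mdifferentiableAt (by simp)
  have hd : mfderiv (𝓡 k) (𝓡 3) P.map u =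
      (mfderiv (𝓡 k) (𝓡 3) Q.map (τ u)).comp (fderiv ℝ τ u) := by
    rw [h.mfderiv_eq, mfderiv_comp u hQ hτ.mdifferentiableAt, mfderiv_eq_fderiv]
    rfl
  have hpt : P.map u = Q.map (τ u) := h.eq_of_nhds
  have := alternating_map_single_det
    ((α (Q.map (τ u))).compContinuousLinearMap (mfderiv (𝓡 k) (𝓡 3) Q.map (τ u)))
    (fderiv ℝ τ u)
  unfold Patch.density
  rw [← abs_mul]
  congr 1
  refine Eq.trans ?_ this
  rw [hd]
  change α (P.map u) (fun i => mfderiv (𝓡 k) (𝓡 3) Q.map (τ u) (fderiv ℝ τ u _)) =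
    α (Q.map (τ u)) (fun i => mfderiv (𝓡 k) (𝓡 3) Q.map (τ u) (fderiv ℝ τ u _))
  rw [hpt]

variable [MeasurableSpace M] [BorelSpace M]

theorem Patch.measure_apply {k : ℕ} {S : Set M} (P : Patch k S) (α : DiffForm M k) {A : Set M}
    (hA : MeasurableSet A) :
    P.measure α A = ∫⁻ u in P.map ⁻¹' A ∩ P.dom, ENNReal.ofReal (P.density α u) := by
  have hm : AEMeasurable P.map ((volume.restrict P.dom).withDensity
      fun u => ENNReal.ofReal (P.density α u)) :=
    (P.smooth.continuousOn.aemeasurable P.isOpen_dom.measurableSet).mono_ac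
      (withDensity_absolutelyContinuous _ _)
  rw [Patch.measure, Measure.map_apply_of_aemeasurable hm hA, withDensity_apply',
    Measure.restrict_restrict' P.isOpen_dom.measurableSet]

/-- A parametrization onto `S ∩ O` with smooth inverse computes the measure of `S` inside `O`. -/
theorem formMeasure_restrict_eq {k : ℕ} {S : Set M} (α : DiffForm M k) (Q : Patch k S)
    {O : Set M} (hO : IsOpen O) (hQO : MapsTo Q.map Q.dom O)
    (χ : M → EuclideanSpace ℝ (Fin k)) (hχ : ContMDiffOn (𝓡 3) (𝓡 k) ∞ χ O)
    (hr : ∀ p ∈ S, p ∈ O → χ p ∈ Q.dom ∧ Q.map (χ p) = p) :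
    (formMeasure α S).restrict O = Q.measure α := by
  -- An arbitrary competitor `P` is compared with `Q` through the transition map `χ ∘ P.map`, which
  -- is smooth and injective where `P` lands in `O`. Change of variables turns the mass of `P` into
  -- the mass of `Q` over the image of that map.
  have key : ∀ P : Patch k S, ∀ A : Set M, MeasurableSet A →
      P.measure α (A ∩ O) ≤ Q.measure α A := by
    intro P A hA
    rw [P.measure_apply α (hA.inter hO.measurableSet), Q.measure_apply α hA]
    set s := P.map ⁻¹' (A ∩ O) ∩ P.dom with hs
    have hPO : IsOpen (P.dom ∩ P.map ⁻¹' O) :=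
      P.smooth.continuousOn.isOpen_inter_preimage P.isOpen_dom hO
    have hτ : ContMDiffOn (𝓡 k) (𝓡 k) ∞ (χ ∘ P.map) (P.dom ∩ P.map ⁻¹' O) :=
      hχ.comp (P.smooth.mono inter_subset_left) inter_subset_right
    rw [contMDiffOn_iff_contDiffOn] at hτ
    have hsub : s ⊆ P.dom ∩ P.map ⁻¹' O := fun u hu => ⟨hu.2, hu.1.2⟩
    have hsm : MeasurableSet s := by
      have hmeas : Measurable (fun u : (P.dom ∩ P.map ⁻¹' O : Set _) => P.map u) :=
        (P.smooth.continuousOn.mono inter_subset_left).domRestrict.measurable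
      have := (hPO.measurableSet).subtype_image (hmeas hA)
      convert this using 1
      ext u
      simp only [hs, mem_inter_iff, mem_preimage, mem_image, Subtype.exists]
      constructor
      · rintro ⟨⟨h1, h2⟩, h3⟩; exact ⟨u, ⟨h3, h2⟩, h1, rfl⟩
      · rintro ⟨v, ⟨h3, h2⟩, h1, rfl⟩; exact ⟨⟨h1, h2⟩, h3⟩
    have hdiff : ∀ u ∈ s, DifferentiableAt ℝ (χ ∘ P.map) u := fun u hu =>
      ((hτ u (hsub hu)).contDiffAt (hPO.mem_nhds (hsub hu))).differentiableAt (by simp)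
    have hS : ∀ u ∈ P.dom ∩ P.map ⁻¹' O, Q.map (χ (P.map u)) = P.map u := fun u hu =>
      (hr _ (P.mapsTo hu.1) hu.2).2
    have hinj : InjOn (χ ∘ P.map) s := by
      intro u hu v hv huv
      apply P.injOn hu.2 hv.2
      rw [← hS u (hsub hu), ← hS v (hsub hv)]
      exact congrArg Q.map huv
    have hcv := lintegral_image_eq_lintegral_abs_det_fderiv_mul volume hsm
      (fun u hu => (hdiff u hu).hasFDerivAt.hasFDerivWithinAt) hinj
      (fun u => ENNReal.ofReal (Q.density α u))
    have heq : ∫⁻ u in s, ENNReal.ofReal (P.density α u) =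
        ∫⁻ u in (χ ∘ P.map) '' s, ENNReal.ofReal (Q.density α u) := by
      rw [hcv]
      refine setLIntegral_congr_fun hsm fun u hu => ?_
      rw [← ENNReal.ofReal_mul (abs_nonneg _)]
      congr 1
      refine P.density_eq_det_mul Q α (hr _ (P.mapsTo hu.2) hu.1.2).1 (hdiff u hu) ?_
      filter_upwards [hPO.mem_nhds (hsub hu)] with v hv using (hS v hv).symm
    rw [heq]
    refine lintegral_mono_set ?_
    rintro _ ⟨u, hu, rfl⟩
    have := hr _ (P.mapsTo hu.2) hu.1.2
    refine ⟨?_, this.1⟩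
    change Q.map (χ (P.map u)) ∈ A
    rw [this.2]; exact hu.1.1
  -- Bounding a supremum of measures takes one measure above them all. Off `O` nothing is known, so
  -- the bound there is `⊤`, which disappears on restricting to `O`.
  have hle : formMeasure α S ≤ Q.measure α + (⊤ : Measure M).restrict Oᶜ := by
    refine iSup_le fun P => Measure.le_iff.2 fun A hA => ?_
    calc P.measure α A ≤ P.measure α (A ∩ O) + P.measure α (A \ O) := by
          rw [measure_inter_add_sdiff _ hO.measurableSet]
      _ ≤ Q.measure α A + (⊤ : Measure M) (A ∩ Oᶜ) := by
          refine add_le_add (key P A hA) ?_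
          rw [sdiff_eq]; exact Measure.le_iff'.1 le_top _
      _ = _ := by
          rw [Measure.add_apply, Measure.restrict_apply hA]
  refine le_antisymm ?_ ?_
  · refine (Measure.restrict_mono le_rfl hle).trans ?_
    rw [Measure.restrict_add, Measure.restrict_restrict hO.measurableSet, inter_compl_self,
      Measure.restrict_empty, add_zero]
    exact Measure.restrict_le_self
  · have h1 : (Q.measure α).restrict O = Q.measure α := by
      refine Measure.ext fun A hA => ?_
      rw [Measure.restrict_apply hA, Q.measure_apply α hA,
        Q.measure_apply α (hA.inter hO.measurableSet)]
      congr 2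
      ext u
      exact ⟨fun h => ⟨h.1.1, h.2⟩, fun h => ⟨⟨h.1, hQO h.2⟩, h.2⟩⟩
    rw [← h1]
    exact Measure.restrict_mono le_rfl (le_iSup (fun P : Patch k S => P.measure α) Q)

end FormMeasure

/-! ### Transport of vectors and vector fields through a chart -/

section ChartPush

variable {M : Type*} [TopologicalSpace M] [ChartedSpace E3 M]

/-- The linear isomorphism `ℝ³ → T_q M` given by the chart around `x₀`. -/
noncomputable def chartPush (x₀ q : M) : E3 →L[ℝ] TangentSpace (𝓡 3) q :=
  mfderiv 𝓘(ℝ, E3) (𝓡 3) (extChartAt (𝓡 3) x₀).symm (extChartAt (𝓡 3) x₀ q)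

theorem DiffForm.inChart_eq_chartPush {k : ℕ} (α : DiffForm M k) {x₀ q : M}
    (hq : q ∈ (extChartAt (𝓡 3) x₀).source) (w : Fin k → E3) :
    α.inChart x₀ (extChartAt (𝓡 3) x₀ q) w = α q (fun i => chartPush x₀ q (w i)) := by
  have h : (extChartAt (𝓡 3) x₀).symm (extChartAt (𝓡 3) x₀ q) = q :=
    (extChartAt (𝓡 3) x₀).left_inv hq
  change α ((extChartAt (𝓡 3) x₀).symm (extChartAt (𝓡 3) x₀ q))
    (fun i => (chartPush x₀ q (w i) : E3)) = α q (fun i => (chartPush x₀ q (w i) : E3))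
  rw [h]

variable [IsManifold (𝓡 3) ∞ M]

theorem mdifferentiableAt_extChartAt_symm' {x₀ q : M} (hq : q ∈ (extChartAt (𝓡 3) x₀).source) :
    MDifferentiableAt 𝓘(ℝ, E3) (𝓡 3) (extChartAt (𝓡 3) x₀).symm (extChartAt (𝓡 3) x₀ q) :=
  ((contMDiffOn_extChartAt_symm (n := ∞) x₀ _ ((extChartAt (𝓡 3) x₀).map_source hq)).contMDiffAt
    ((isOpen_extChartAt_target x₀).mem_nhds
      ((extChartAt (𝓡 3) x₀).map_source hq))).mdifferentiableAt (by simp)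

theorem mfderiv_chartPush {x₀ q : M} (hq : q ∈ (extChartAt (𝓡 3) x₀).source) {Φ : M → ℝ}
    (hΦ : MDifferentiableAt (𝓡 3) 𝓘(ℝ, ℝ) Φ q) (v : E3) :
    mfderiv (𝓡 3) 𝓘(ℝ, ℝ) Φ q (chartPush x₀ q v) =
      fderiv ℝ (Φ ∘ (extChartAt (𝓡 3) x₀).symm) (extChartAt (𝓡 3) x₀ q) v := by
  have h : (extChartAt (𝓡 3) x₀).symm (extChartAt (𝓡 3) x₀ q) = q :=
    (extChartAt (𝓡 3) x₀).left_inv hq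
  rw [← mfderiv_eq_fderiv, mfderiv_comp (I' := 𝓡 3) _ (by rwa [h])
    (mdifferentiableAt_extChartAt_symm' hq)]
  change _ = mfderiv (𝓡 3) 𝓘(ℝ, ℝ) Φ ((extChartAt (𝓡 3) x₀).symm (extChartAt (𝓡 3) x₀ q))
    (chartPush x₀ q v : E3)
  rw [h]

theorem chartPush_surjective {x₀ q : M} (hq : q ∈ (extChartAt (𝓡 3) x₀).source) :
    Function.Surjective (chartPush x₀ q) := by
  intro u
  have h : (extChartAt (𝓡 3) x₀).symm (extChartAt (𝓡 3) x₀ q) = q :=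
    (extChartAt (𝓡 3) x₀).left_inv hq
  have hmd : MDifferentiableAt (𝓡 3) 𝓘(ℝ, E3) (extChartAt (𝓡 3) x₀) q :=
    mdifferentiableAt_extChartAt (by simpa using hq)
  refine ⟨mfderiv (𝓡 3) 𝓘(ℝ, E3) (extChartAt (𝓡 3) x₀) q u, ?_⟩
  have hc := mfderiv_comp (I := 𝓡 3) (I' := 𝓘(ℝ, E3)) (I'' := 𝓡 3) q
    (mdifferentiableAt_extChartAt_symm' hq) hmd
  have hid : (extChartAt (𝓡 3) x₀).symm ∘ extChartAt (𝓡 3) x₀ =ᶠ[𝓝 q] id := by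
    filter_upwards [(isOpen_extChartAt_source x₀).mem_nhds hq] with p hp
    exact (extChartAt (𝓡 3) x₀).left_inv hp
  rw [hid.mfderiv_eq, mfderiv_id] at hc
  exact (congrArg (fun L : E3 →L[ℝ] E3 => L u) hc).symm

theorem chartPush_injective {x₀ q : M} (hq : q ∈ (extChartAt (𝓡 3) x₀).source) :
    Function.Injective (chartPush x₀ q) :=
  (LinearMap.injective_iff_surjective (f := (show E3 →L[ℝ] E3 from chartPush x₀ q).toLinearMap)).2
    (chartPush_surjective hq)

/-- The field is the section `y ↦ (y, v y)`, preceded by the chart and followed by the tangent map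
of the inverse chart. -/
theorem isSmoothVectorFieldOn_chartPush {x₀ : M} {U : Set M}
    (hU : U ⊆ (extChartAt (𝓡 3) x₀).source) {v : E3 → E3} {W : Set E3}
    (hW : MapsTo (extChartAt (𝓡 3) x₀) U W) (hv : ContDiffOn ℝ ∞ v W) :
    IsSmoothVectorFieldOn (fun q => chartPush x₀ q (v (extChartAt (𝓡 3) x₀ q))) U := by
  have hT : IsOpen (extChartAt (𝓡 3) x₀).target := isOpen_extChartAt_target x₀
  have h1 := (contMDiffOn_extChartAt_symm (I := 𝓡 3) (n := ∞) x₀).contMDiffOn_tangentMapWithin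
    (m := ∞) (by simp) hT.uniqueMDiffOn
  have h2 : ContMDiffOn 𝓘(ℝ, E3) 𝓘(ℝ, E3).tangent ∞
      (fun y => (⟨y, v y⟩ : TangentBundle 𝓘(ℝ, E3) E3)) W :=
    contMDiffOn_vectorSpace_iff_contDiffOn.2 hv
  have h3 : ContMDiffOn (𝓡 3) 𝓘(ℝ, E3) ∞ (extChartAt (𝓡 3) x₀) U :=
    contMDiffOn_extChartAt.mono (by simpa using hU)
  refine (h1.comp (h2.comp h3 hW) ?_).congr ?_
  · intro q hq
    exact (extChartAt (𝓡 3) x₀).map_source (hU hq)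
  · intro q hq
    have h : (extChartAt (𝓡 3) x₀).symm (extChartAt (𝓡 3) x₀ q) = q :=
      (extChartAt (𝓡 3) x₀).left_inv (hU hq)
    have hpt : ∀ (p p' : M) (w : E3), p = p' →
        (⟨p, w⟩ : TangentBundle (𝓡 3) M) = ⟨p', w⟩ := by rintro p _ w rfl; rfl
    simp only [Function.comp_apply, tangentMapWithin]
    rw [mfderivWithin_of_isOpen hT ((extChartAt (𝓡 3) x₀).map_source (hU hq))]
    exact hpt _ _ _ h.symm

end ChartPush

/-! ### Local smooth frames of the distribution -/

section Frame

/-- A one-form on a vector space, as a linear functional. -/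
noncomputable def oneFormFunctional (β : E3 [⋀^Fin 1]→L[ℝ] ℝ) : E3 →L[ℝ] ℝ :=
  (ContinuousAlternatingMap.ofSubsingleton ℝ E3 ℝ (0 : Fin 1)).symm β

theorem oneFormFunctional_apply (β : E3 [⋀^Fin 1]→L[ℝ] ℝ) (v : E3) :
    oneFormFunctional β v = β ![v] := by
  have h : ![v] = fun _ => v := by ext1 i; simp
  rw [h]
  rfl

theorem exists_complementary_indices (i : Fin 3) : ∃ j k : Fin 3, i ≠ j ∧ i ≠ k ∧ j ≠ k ∧
    ∀ v : E3, v = v i • EuclideanSpace.single i 1 + v j • EuclideanSpace.single j 1 +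
      v k • EuclideanSpace.single k (1 : ℝ) := by
  fin_cases i
  · refine ⟨1, 2, by decide, by decide, by decide, fun v => ?_⟩
    ext l; fin_cases l <;> simp
  · refine ⟨0, 2, by decide, by decide, by decide, fun v => ?_⟩
    ext l; fin_cases l <;> simp
  · refine ⟨0, 1, by decide, by decide, by decide, fun v => ?_⟩
    ext l; fin_cases l <;> simp

variable {M : Type*} [TopologicalSpace M] [ChartedSpace E3 M] [IsManifold (𝓡 3) ∞ M]

/-- Of the contact condition only `η ≠ 0` is used: the kernel of a nowhere zero smooth one-form on
`ℝ³` has an explicit frame in its coefficients. -/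
theorem ContactStructure.exists_local_frame (C : ContactStructure M) (x₀ : M) :
    ∃ U : Set M, IsOpen U ∧ x₀ ∈ U ∧ ∃ X₁ X₂ : ∀ p : M, C.D p,
      IsSmoothVectorFieldOn (fun p => (X₁ p : TangentSpace (𝓡 3) p)) U ∧
      IsSmoothVectorFieldOn (fun p => (X₂ p : TangentSpace (𝓡 3) p)) U ∧
      ∀ q ∈ U, X₁ q ≠ 0 ∧ (∀ c : ℝ, X₂ q ≠ c • X₁ q) ∧
        ∀ u : C.D q, ∃ a b : ℝ, u = a • X₁ q + b • X₂ q := by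
  classical
  obtain ⟨U, hU, hxU, η, hη, hD⟩ := C.contact x₀
  set φ := extChartAt (𝓡 3) x₀ with hφ
  have hx₀ : x₀ ∈ φ.source := mem_extChartAt_source x₀
  set W : Set E3 := φ.target ∩ φ.symm ⁻¹' U with hW
  have hWo : IsOpen W := (continuousOn_extChartAt_symm x₀).isOpen_inter_preimage
    (isOpen_extChartAt_target x₀) hU
  let a : E3 → E3 →L[ℝ] ℝ := fun y => oneFormFunctional (η.inChart x₀ y)
  have ha : ∀ e : E3, ContDiffOn ℝ ∞ (fun y => a y e) W := fun e => by
    have := (ContinuousAlternatingMap.apply ℝ E3 ℝ ![e]).contDiff.comp_contDiffOn (hη x₀)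
    exact this.congr fun y _ => oneFormFunctional_apply _ _
  have hηa : ∀ q ∈ φ.source, ∀ v : E3, η q ![chartPush x₀ q v] = a (φ q) v := fun q hq v => by
    rw [oneFormFunctional_apply, η.inChart_eq_chartPush hq]
    congr 1; ext i; simp
  -- Every term of `η ∧ dη` contains a value of `η`, so `η` cannot vanish at `x₀`.
  obtain ⟨i, hi⟩ : ∃ i : Fin 3, a (φ x₀) (EuclideanSpace.single i 1) ≠ 0 := by
    by_contra! hcon
    have h0 : ∀ u, η x₀ ![u] = 0 := fun u => by
      obtain ⟨v, rfl⟩ := chartPush_surjective hx₀ u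
      rw [hηa x₀ hx₀]
      obtain ⟨j, k, -, -, -, hv⟩ := exists_complementary_indices 0
      rw [hv v]; simp [hcon]
    obtain ⟨u, v, w, h⟩ := (hD x₀ hxU).2
    exact h (by simp [DiffForm.wedge, h0])
  obtain ⟨j, k, hij, hik, hjk, hdec⟩ := exists_complementary_indices i
  let c : Fin 3 → E3 → ℝ := fun l y => a y (EuclideanSpace.single l 1)
  have hc : ∀ l, ContDiffOn ℝ ∞ (c l) W := fun l => ha _
  -- With `c l` the coefficients of `η`, the vectors `c_i e_l - c_l e_i` for `l ≠ i` lie in the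
  -- kernel, and span it where `c_i ≠ 0`.
  let v : Fin 3 → E3 → E3 := fun l y =>
    c i y • EuclideanSpace.single l 1 - c l y • EuclideanSpace.single i 1
  have hv : ∀ l, ContDiffOn ℝ ∞ (v l) W := fun l =>
    ((hc i).smul contDiffOn_const).sub ((hc l).smul contDiffOn_const)
  have hav : ∀ l y, a y (v l y) = 0 := fun l y => by
    simp only [v, map_sub, map_smul, smul_eq_mul, c]; ring
  have hdec' : ∀ y w, a y w = 0 → c i y ≠ 0 →
      w = (w j / c i y) • v j y + (w k / c i y) • v k y := by
    intro y w hw hne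
    have h1 : w i * c i y + w j * c j y + w k * c k y = 0 := by
      rw [hdec w] at hw
      simpa only [map_add, map_smul, smul_eq_mul] using hw
    have h2 : w i = -(w j / c i y * c j y) - w k / c i y * c k y := by
      field_simp; linarith
    conv_lhs => rw [hdec w, h2]
    have h3 : w j = w j / c i y * c i y := by field_simp
    have h4 : w k = w k / c i y * c i y := by field_simp
    simp only [v]
    generalize w j / c i y = s at *
    generalize w k / c i y = t at *
    rw [h3, h4]
    module
  set U' : Set M := φ.source ∩ φ ⁻¹' (W ∩ {y | c i y ≠ 0}) with hU'
  have hV : IsOpen (W ∩ {y | c i y ≠ 0}) :=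
    (hc i).continuousOn.isOpen_inter_preimage hWo isOpen_ne
  have hU'o : IsOpen U' :=
    (continuousOn_extChartAt x₀).isOpen_inter_preimage (isOpen_extChartAt_source x₀) hV
  have hker : ∀ q ∈ U', ∀ w : E3, chartPush x₀ q w ∈ C.D q ↔ a (φ q) w = 0 := by
    intro q hq w
    have hqU : q ∈ U := by
      have := hq.2.1.2
      rwa [mem_preimage, φ.left_inv hq.1] at this
    rw [(hD q hqU).1, hηa q hq.1]
  -- `g_smooth` takes horizontal fields defined on all of `M`; the value zero off `U'` is a filler.
  let X : Fin 3 → ∀ q : M, C.D q := fun l q =>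
    if h : q ∈ U' then ⟨chartPush x₀ q (v l (φ q)), (hker q h _).2 (hav _ _)⟩ else 0
  have hX : ∀ l, ∀ q ∈ U', (X l q : TangentSpace (𝓡 3) q) = chartPush x₀ q (v l (φ q)) :=
    fun l q hq => by simp only [X, dif_pos hq]
  have hXs : ∀ l, IsSmoothVectorFieldOn (fun p => (X l p : TangentSpace (𝓡 3) p)) U' := by
    intro l
    refine (isSmoothVectorFieldOn_chartPush (x₀ := x₀) (U := U') inter_subset_left (W := W)
      (fun q hq => hq.2.1) (hv l)).congr fun q hq => ?_
    exact congrArg (fun w => (⟨q, w⟩ : TangentBundle (𝓡 3) M)) (hX l q hq)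
  refine ⟨U', hU'o, ⟨hx₀, ⟨φ.map_source hx₀, ?_⟩, hi⟩, X j, X k, hXs j, hXs k, ?_⟩
  · rw [mem_preimage, φ.left_inv hx₀]; exact hxU
  intro q hq
  have hne : c i (φ q) ≠ 0 := hq.2.2
  have hinj := chartPush_injective (x₀ := x₀) hq.1
  refine ⟨fun h => ?_, fun s h => ?_, fun u => ?_⟩
  · have h1 : chartPush x₀ q (v j (φ q)) = 0 := by rw [← hX j q hq, h]; rfl
    rw [map_eq_zero_iff _ hinj] at h1
    have := congrArg (fun w : E3 => w j) h1
    simp [v, hij.symm] at this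
    exact hne this
  · have h1 : chartPush x₀ q (v k (φ q)) = chartPush x₀ q (s • v j (φ q)) := by
      rw [map_smul, ← hX j q hq, ← hX k q hq, h]; rfl
    have := congrArg (fun w : E3 => w k) (hinj h1)
    simp [v, hik.symm, hjk.symm] at this
    exact hne this
  · obtain ⟨w, hw⟩ := chartPush_surjective hq.1 (u : TangentSpace (𝓡 3) q)
    have haw : a (φ q) w = 0 := (hker q hq w).1 (hw ▸ u.2)
    refine ⟨w j / c i (φ q), w k / c i (φ q), Subtype.ext ?_⟩
    rw [Submodule.coe_add, Submodule.coe_smul, Submodule.coe_smul, hX j q hq, hX k q hq,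
      ← map_smul, ← map_smul, ← map_add, ← hdec' _ _ haw hne, hw]

end Frame

/-! ### Continuity of the norm of the horizontal gradient -/

section Gradient

variable {M : Type*} [TopologicalSpace M] [ChartedSpace E3 M] [IsManifold (𝓡 3) ∞ M]

theorem continuousOn_mfderiv_vectorField {Φ : M → ℝ} (hΦ : ContMDiff (𝓡 3) 𝓘(ℝ, ℝ) ∞ Φ)
    {X : ∀ p : M, TangentSpace (𝓡 3) p} {U : Set M} (hX : IsSmoothVectorFieldOn X U) :
    ContinuousOn (fun q => mfderiv (𝓡 3) 𝓘(ℝ, ℝ) Φ q (X q)) U := by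
  have h1 : Continuous (tangentMap (𝓡 3) 𝓘(ℝ, ℝ) Φ) := hΦ.continuous_tangentMap (by simp)
  have h2 := (tangentBundleModelSpaceHomeomorph 𝓘(ℝ, ℝ)).continuous.comp_continuousOn
    (h1.comp_continuousOn hX.continuousOn)
  exact continuous_snd.comp_continuousOn h2

/-- In a frame with Gram matrix `G` and `b_l = dΦ(X_l)`, the squared norm is `bᵀ G⁻¹ b`. All its
ingredients are continuous, so no regularity of the gradient field itself is required. -/
theorem ContactStructure.continuous_norm_horizontalGradient (C : ContactStructure M) {Φ : M → ℝ}
    (hΦ : ContMDiff (𝓡 3) 𝓘(ℝ, ℝ) ∞ Φ) :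
    Continuous fun p => C.norm p (C.horizontalGradient Φ p) := by
  refine Real.continuous_sqrt.comp (continuous_iff_continuousAt.2 fun x₀ => ?_)
  obtain ⟨U, hU, hx₀, X₁, X₂, hX₁, hX₂, hframe⟩ := C.exists_local_frame x₀
  have g11 := (C.g_smooth U hU X₁ X₁ hX₁ hX₁).continuousOn
  have g12 := (C.g_smooth U hU X₁ X₂ hX₁ hX₂).continuousOn
  have g22 := (C.g_smooth U hU X₂ X₂ hX₂ hX₂).continuousOn
  have b1 : ContinuousOn (fun q => C.g q (C.horizontalGradient Φ q) (X₁ q)) U :=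
    (continuousOn_mfderiv_vectorField hΦ hX₁).congr fun q _ => C.horizontalGradient_spec Φ q (X₁ q)
  have b2 : ContinuousOn (fun q => C.g q (C.horizontalGradient Φ q) (X₂ q)) U :=
    (continuousOn_mfderiv_vectorField hΦ hX₂).congr fun q _ => C.horizontalGradient_spec Φ q (X₂ q)
  -- With `v = g₁₁ X₂ - g₁₂ X₁ ≠ 0` one has `g(v, v) = g₁₁ (g₁₁ g₂₂ - g₁₂²)`, so the Gram
  -- determinant is positive.
  have hdet : ∀ q ∈ U, C.g q (X₁ q) (X₁ q) * C.g q (X₂ q) (X₂ q) - C.g q (X₁ q) (X₂ q) ^ 2 ≠ 0 := by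
    intro q hq
    obtain ⟨h1, h2, -⟩ := hframe q hq
    have h11 := C.g_pos q _ h1
    have hv : C.g q (X₁ q) (X₁ q) • X₂ q - C.g q (X₁ q) (X₂ q) • X₁ q ≠ 0 := by
      intro h
      refine h2 ((C.g q (X₁ q) (X₁ q))⁻¹ * C.g q (X₁ q) (X₂ q)) ?_
      rw [mul_smul, ← sub_eq_zero.1 h, smul_smul, inv_mul_cancel₀ h11.ne', one_smul]
    have h3 := C.g_pos q _ hv
    simp only [map_sub, map_smul, LinearMap.sub_apply, LinearMap.smul_apply, smul_eq_mul,
      C.g_symm q (X₂ q) (X₁ q)] at h3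
    intro h
    nlinarith
  have hcont : ContinuousOn (fun q =>
      (C.g q (X₂ q) (X₂ q) * C.g q (C.horizontalGradient Φ q) (X₁ q) ^ 2
        - 2 * C.g q (X₁ q) (X₂ q) * C.g q (C.horizontalGradient Φ q) (X₁ q)
          * C.g q (C.horizontalGradient Φ q) (X₂ q)
        + C.g q (X₁ q) (X₁ q) * C.g q (C.horizontalGradient Φ q) (X₂ q) ^ 2) /
      (C.g q (X₁ q) (X₁ q) * C.g q (X₂ q) (X₂ q) - C.g q (X₁ q) (X₂ q) ^ 2)) U :=
    ContinuousOn.div (((g22.mul (b1.pow 2)).sub (((continuousOn_const.mul g12).mul b1).mul b2)).add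
      (g11.mul (b2.pow 2))) ((g11.mul g22).sub (g12.pow 2)) hdet
  refine (hcont.congr fun q hq => ?_).continuousAt (hU.mem_nhds hx₀)
  rw [eq_div_iff (hdet q hq)]
  obtain ⟨a, b, hab⟩ := (hframe q hq).2.2 (C.horizontalGradient Φ q)
  have e1 : C.g q (C.horizontalGradient Φ q) (X₁ q) =
      a * C.g q (X₁ q) (X₁ q) + b * C.g q (X₁ q) (X₂ q) := by
    rw [hab]
    simp [C.g_symm q (X₂ q) (X₁ q)]
  have e2 : C.g q (C.horizontalGradient Φ q) (X₂ q) =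
      a * C.g q (X₁ q) (X₂ q) + b * C.g q (X₂ q) (X₂ q) := by
    rw [hab]
    simp
  have e3 : C.g q (C.horizontalGradient Φ q) (C.horizontalGradient Φ q) =
      a * (a * C.g q (X₁ q) (X₁ q) + b * C.g q (X₁ q) (X₂ q)) +
      b * (a * C.g q (X₁ q) (X₂ q) + b * C.g q (X₂ q) (X₂ q)) := by
    rw [hab]
    simp only [map_add, map_smul, LinearMap.add_apply, LinearMap.smul_apply, smul_eq_mul,
      C.g_symm q (X₂ q) (X₁ q)]
  rw [e3, e1, e2]
  ring

end Gradient

/-- The two-dimensional model space `ℝ²`. -/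
abbrev E2 : Type := EuclideanSpace ℝ (Fin 2)

/-! ### Slicing `ℝ³` by the planes of constant first coordinate -/

section Slice

/-- The inclusion of `ℝ²` into `ℝ³` as the plane of the last two coordinates. -/
noncomputable def planeIncl : E2 →L[ℝ] E3 :=
  (EuclideanSpace.proj (0 : Fin 2) : E2 →L[ℝ] ℝ).smulRight (EuclideanSpace.single 1 1) +
    (EuclideanSpace.proj (1 : Fin 2) : E2 →L[ℝ] ℝ).smulRight (EuclideanSpace.single 2 1)

/-- The projection of `ℝ³` to the last two coordinates. -/
noncomputable def planeProj : E3 →L[ℝ] E2 :=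
  (EuclideanSpace.proj (1 : Fin 3) : E3 →L[ℝ] ℝ).smulRight (EuclideanSpace.single 0 1) +
    (EuclideanSpace.proj (2 : Fin 3) : E3 →L[ℝ] ℝ).smulRight (EuclideanSpace.single 1 1)

/-- The point of `ℝ³` with first coordinate `t` and last two coordinates `y`. -/
noncomputable def slice (t : ℝ) (y : E2) : E3 := t • EuclideanSpace.single 0 1 + planeIncl y

theorem slice_zero (t : ℝ) (y : E2) : slice t y 0 = t := by simp [slice, planeIncl]

theorem planeProj_slice (t : ℝ) (y : E2) : planeProj (slice t y) = y := by
  ext i; fin_cases i <;> simp [slice, planeIncl, planeProj]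

theorem slice_planeProj (z : E3) : slice (z 0) (planeProj z) = z := by
  ext i; fin_cases i <;> simp [slice, planeIncl, planeProj]

theorem planeIncl_single (i : Fin 2) :
    planeIncl (EuclideanSpace.single i 1) = EuclideanSpace.single i.succ 1 := by
  ext j; fin_cases i <;> fin_cases j <;> simp [planeIncl]

theorem planeIncl_injective : Function.Injective planeIncl := fun y y' h => by
  rw [← planeProj_slice 0 y, ← planeProj_slice 0 y', slice, slice, h]

theorem hasFDerivAt_slice (t : ℝ) (y : E2) : HasFDerivAt (slice t) planeIncl y :=
  planeIncl.hasFDerivAt.const_add _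

theorem contDiff_slice (t : ℝ) : ContDiff ℝ ∞ (slice t) :=
  contDiff_const.add planeIncl.contDiff

theorem measurePreserving_slice :
    MeasurePreserving (fun p : ℝ × E2 => slice p.1 p.2) volume volume := by
  have h1 : MeasurePreserving (Prod.map id (WithLp.ofLp) : ℝ × E2 → ℝ × (Fin 2 → ℝ))
      volume volume :=
    (MeasurePreserving.id volume).prod (PiLp.volume_preserving_ofLp (Fin 2))
  have h2 := (volume_preserving_piFinSuccAbove (fun _ : Fin 3 => ℝ) 0).symm
  have h3 := PiLp.volume_preserving_toLp (Fin 3)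
  convert! h3.comp (h2.comp h1) using 1
  ext p i
  fin_cases i <;> simp [slice, planeIncl, MeasurableEquiv.piFinSuccAbove, Fin.insertNthEquiv]
  rfl

/-- The components of `n` along the plane repeat an argument of `β` and contribute nothing. -/
theorem alternating_map_vecCons (β : E3 [⋀^Fin 3]→L[ℝ] ℝ) (n : E3) :
    β (Matrix.vecCons n fun i : Fin 2 => EuclideanSpace.single i.succ 1) =
      n 0 * β fun i => EuclideanSpace.single i 1 := by
  have hn : n = n 0 • EuclideanSpace.single 0 1 + n 1 • EuclideanSpace.single 1 1 +
      n 2 • EuclideanSpace.single 2 (1 : ℝ) := by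
    ext i; fin_cases i <;> simp
  have key : ∀ m : E3, β (Matrix.vecCons m fun i : Fin 2 => EuclideanSpace.single i.succ 1) =
      β.curryLeft m (fun i : Fin 2 => EuclideanSpace.single i.succ 1) := fun m => rfl
  have h0 : β (Matrix.vecCons (EuclideanSpace.single 0 1)
      fun i : Fin 2 => EuclideanSpace.single i.succ 1) =
      β fun i => EuclideanSpace.single i 1 := by
    congr 1; ext i : 1; refine Fin.cases ?_ (fun j => ?_) i <;> simp
  have h1 : β (Matrix.vecCons (EuclideanSpace.single 1 1)
      fun i : Fin 2 => EuclideanSpace.single i.succ 1) = 0 :=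
    β.map_eq_zero_of_eq _ (i := 0) (j := 1) rfl (by decide)
  have h2 : β (Matrix.vecCons (EuclideanSpace.single 2 1)
      fun i : Fin 2 => EuclideanSpace.single i.succ 1) = 0 :=
    β.map_eq_zero_of_eq _ (i := 0) (j := 2) rfl (by decide)
  rw [key] at h0 h1 h2 ⊢
  conv_lhs => rw [hn]
  simp only [map_add, map_smul, ContinuousAlternatingMap.add_apply,
    ContinuousAlternatingMap.smul_apply, h0, h1, h2, smul_eq_mul, mul_zero, add_zero]

end Slice

/-! ### Charts with `Φ` as first coordinate -/

section AdaptedChart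

variable {M : Type*} [TopologicalSpace M] [ChartedSpace E3 M]

/-- A smooth chart, with domain inside that of the chart around `x₀`, whose first coordinate is
the function `Φ`. -/
structure AdaptedChart (Φ : M → ℝ) (x₀ : M) where
  e : OpenPartialHomeomorph M E3
  source_subset : e.source ⊆ (extChartAt (𝓡 3) x₀).source
  mem_source : x₀ ∈ e.source
  smooth : ContMDiffOn (𝓡 3) 𝓘(ℝ, E3) ∞ e e.source
  smooth_symm : ContMDiffOn 𝓘(ℝ, E3) (𝓡 3) ∞ e.symm e.target
  apply_zero : ∀ p ∈ e.source, e p 0 = Φ p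

/-- If `a` represents `ℓ` by Riesz and `B` is invertible with `B e₀ = a`, then `⟪e₀, B* v⟫ = ⟪a, v⟫
= ℓ v`, so the adjoint `B*` serves as `A`. -/
theorem exists_continuousLinearEquiv_zero_eq {ℓ : E3 →L[ℝ] ℝ} (hℓ : ℓ ≠ 0) :
    ∃ A : E3 ≃L[ℝ] E3, ∀ v, A v 0 = ℓ v := by
  set a : E3 := (InnerProductSpace.toDual ℝ E3).symm ℓ with ha
  have ha0 : a ≠ 0 := by simpa [ha] using hℓ
  have haℓ : ∀ v, inner ℝ a v = ℓ v := fun v => by simp [ha]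
  have hs : (EuclideanSpace.single 0 1 : E3) ≠ 0 := by simp
  obtain ⟨B, hB⟩ := SeparatingDual.exists_continuousLinearEquiv_apply_eq (R := ℝ) hs ha0
  have hinj : Function.Injective (ContinuousLinearMap.adjoint (B : E3 →L[ℝ] E3)) := by
    rw [injective_iff_map_eq_zero]
    intro v hv
    refine ext_inner_left ℝ fun w => ?_
    obtain ⟨u, rfl⟩ := B.surjective w
    have := ContinuousLinearMap.adjoint_inner_right (B : E3 →L[ℝ] E3) u v
    rw [hv, inner_zero_right] at this
    rw [inner_zero_right]
    exact this.symm
  let A : E3 ≃ₗ[ℝ] E3 := LinearEquiv.ofInjectiveEndo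
    (ContinuousLinearMap.adjoint (B : E3 →L[ℝ] E3)).toLinearMap hinj
  refine ⟨A.toContinuousLinearEquiv, fun v => ?_⟩
  have h := ContinuousLinearMap.adjoint_inner_right (B : E3 →L[ℝ] E3) (EuclideanSpace.single 0 1) v
  rw [← haℓ v, ← hB]
  refine Eq.trans ?_ h
  rw [EuclideanSpace.inner_single_left]
  simp [A]

variable [IsManifold (𝓡 3) ∞ M]

theorem exists_adaptedChart {Φ : M → ℝ} (hΦ : ContMDiff (𝓡 3) 𝓘(ℝ, ℝ) ∞ Φ) {x₀ : M}
    (h0 : mfderiv (𝓡 3) 𝓘(ℝ, ℝ) Φ x₀ ≠ 0) : Nonempty (AdaptedChart Φ x₀) := by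
  set φ := extChartAt (𝓡 3) x₀ with hφ
  have hx₀ : x₀ ∈ φ.source := mem_extChartAt_source x₀
  have hT : IsOpen φ.target := isOpen_extChartAt_target x₀
  set F : E3 → ℝ := Φ ∘ φ.symm with hF
  have hFs : ContDiffOn ℝ ∞ F φ.target :=
    contMDiffOn_iff_contDiffOn.1 (hΦ.comp_contMDiffOn (contMDiffOn_extChartAt_symm x₀))
  set y₀ := φ x₀ with hy₀
  have hy₀T : y₀ ∈ φ.target := φ.map_source hx₀
  set ℓ := fderiv ℝ F y₀ with hℓ
  have hℓ0 : ℓ ≠ 0 := by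
    intro h
    apply h0
    ext u
    obtain ⟨v, rfl⟩ := chartPush_surjective hx₀ u
    rw [mfderiv_chartPush hx₀ (hΦ.mdifferentiableAt (by simp))]
    change ℓ v = 0
    rw [h]; rfl
  obtain ⟨A, hA⟩ := exists_continuousLinearEquiv_zero_eq hℓ0
  -- The correction along `e₀` makes the first coordinate exactly `F`. It vanishes to first order at
  -- `y₀` up to a constant, so the derivative there is the invertible `A` and the inverse function
  -- theorem applies.
  set G : E3 → E3 := fun y => A y + (F y - ℓ y) • EuclideanSpace.single 0 (1 : ℝ) with hG
  have hG0 : ∀ y, G y 0 = F y := fun y => by simp [hG, hA]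
  have hGs : ContDiffOn ℝ ∞ G φ.target :=
    A.contDiff.contDiffOn.add ((hFs.sub ℓ.contDiff.contDiffOn).smul contDiffOn_const)
  have hGat : ∀ y ∈ φ.target, ContDiffAt ℝ ∞ G y := fun y hy => hGs.contDiffAt (hT.mem_nhds hy)
  have hGd : HasFDerivAt G (A : E3 →L[ℝ] E3) y₀ := by
    have hFd : HasFDerivAt F ℓ y₀ :=
      ((hFs.contDiffAt (hT.mem_nhds hy₀T)).differentiableAt (by simp)).hasFDerivAt
    have h := A.hasFDerivAt.add ((hFd.sub ℓ.hasFDerivAt).smul_const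
      (EuclideanSpace.single 0 (1 : ℝ)) : HasFDerivAt _ _ y₀)
    convert! h using 1
    ext v : 1; simp
  -- Restricting to the open set where the derivative of `G` is invertible makes the local inverse
  -- smooth on its whole domain, not only near `G y₀`.
  set N : Set E3 := φ.target ∩ fderiv ℝ G ⁻¹' range ((↑) : (E3 ≃L[ℝ] E3) → E3 →L[ℝ] E3) with hN
  have hNo : IsOpen N := (hGs.continuousOn_fderiv_of_isOpen hT (by simp)).isOpen_inter_preimage hT
    ContinuousLinearEquiv.isOpen
  let G₀ := (hGat y₀ hy₀T).toOpenPartialHomeomorph G hGd (by simp)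
  let G₁ := G₀.restrOpen N hNo
  have hG₁s : G₁.source ⊆ N := fun y hy => hy.2
  have hy₀1 : y₀ ∈ G₁.source :=
    ⟨(hGat y₀ hy₀T).mem_toOpenPartialHomeomorph_source hGd (by simp), hy₀T, A, hGd.fderiv.symm⟩
  have hG₁symm : ContDiffOn ℝ ∞ G₁.symm G₁.target := by
    intro z hz
    have hz' := hG₁s (G₁.map_target hz)
    obtain ⟨f', hf'⟩ := hz'.2
    refine (G₁.contDiffAt_symm (f₀' := f') hz ?_ (hGat _ hz'.1)).contDiffWithinAt
    rw [hf']
    exact ((hGat _ hz'.1).differentiableAt (by simp)).hasFDerivAt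
  refine ⟨⟨(chartAt E3 x₀).trans G₁, ?_, ?_, ?_, ?_, ?_⟩⟩
  · intro p hp
    rw [OpenPartialHomeomorph.trans_source] at hp
    simpa using hp.1
  · rw [OpenPartialHomeomorph.trans_source]
    exact ⟨by simp, hy₀1⟩
  · rw [OpenPartialHomeomorph.trans_source]
    exact ((hGs.mono (fun y hy => (hG₁s hy).1)).contMDiffOn (s := G₁.source)).comp
      ((contMDiffOn_extChartAt (I := 𝓡 3) (n := ∞) (x := x₀)).mono inter_subset_left)
      (fun p hp => hp.2)
  · rw [OpenPartialHomeomorph.trans_target]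
    refine (contMDiffOn_extChartAt_symm (I := 𝓡 3) (n := ∞) x₀).comp
      (hG₁symm.contMDiffOn.mono inter_subset_left) (fun p hp => ?_)
    exact (hG₁s (G₁.map_target hp.1)).1
  · intro p hp
    rw [OpenPartialHomeomorph.trans_source] at hp
    have hp1 : p ∈ φ.source := by simpa [hφ] using hp.1
    refine (hG0 (φ p)).trans ?_
    simp only [hF, Function.comp_apply, φ.left_inv hp1]

end AdaptedChart

/-! ### The coarea formula in adapted charts, and patching -/

section Coarea

variable {M : Type*} [TopologicalSpace M] [ChartedSpace E3 M]

namespace AdaptedChart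

variable {Φ : M → ℝ} {x₀ : M} (a : AdaptedChart Φ x₀)

theorem symm_mdifferentiableAt {z : E3} (hz : z ∈ a.e.target) :
    MDifferentiableAt 𝓘(ℝ, E3) (𝓡 3) a.e.symm z :=
  ((a.smooth_symm z hz).contMDiffAt (a.e.open_target.mem_nhds hz)).mdifferentiableAt (by simp)

theorem mdifferentiableAt {p : M} (hp : p ∈ a.e.source) :
    MDifferentiableAt (𝓡 3) 𝓘(ℝ, E3) a.e p :=
  ((a.smooth p hp).contMDiffAt (a.e.open_source.mem_nhds hp)).mdifferentiableAt (by simp)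

/-- The derivative of the inverse of an adapted chart. -/
noncomputable def dsymm (z : E3) : E3 →L[ℝ] TangentSpace (𝓡 3) (a.e.symm z) :=
  mfderiv 𝓘(ℝ, E3) (𝓡 3) a.e.symm z

theorem dsymm_injective {z : E3} (hz : z ∈ a.e.target) : Function.Injective (a.dsymm z) := by
  have hc := mfderiv_comp (I := 𝓘(ℝ, E3)) (I' := 𝓡 3) (I'' := 𝓘(ℝ, E3)) z
    (a.mdifferentiableAt (a.e.map_target hz)) (a.symm_mdifferentiableAt hz)
  have hid : a.e ∘ a.e.symm =ᶠ[𝓝 z] id := by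
    filter_upwards [a.e.open_target.mem_nhds hz] with y hy using a.e.right_inv hy
  rw [hid.mfderiv_eq, mfderiv_id] at hc
  refine Function.LeftInverse.injective
    (g := mfderiv (𝓡 3) 𝓘(ℝ, E3) a.e (a.e.symm z)) fun v => ?_
  exact (congrArg (fun L : E3 →L[ℝ] E3 => L v) hc).symm

theorem dsymm_surjective {z : E3} (hz : z ∈ a.e.target) : Function.Surjective (a.dsymm z) :=
  (LinearMap.injective_iff_surjective
    (f := (show E3 →L[ℝ] E3 from a.dsymm z).toLinearMap)).1 (a.dsymm_injective hz)

theorem mfderiv_dsymm (hΦ : ContMDiff (𝓡 3) 𝓘(ℝ, ℝ) ∞ Φ) {z : E3} (hz : z ∈ a.e.target) (v : E3) :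
    mfderiv (𝓡 3) 𝓘(ℝ, ℝ) Φ (a.e.symm z) (a.dsymm z v) = v 0 := by
  have hc := mfderiv_comp (I := 𝓘(ℝ, E3)) (I' := 𝓡 3) (I'' := 𝓘(ℝ, ℝ)) z
    (hΦ.mdifferentiableAt (by simp)) (a.symm_mdifferentiableAt hz)
  have hid : Φ ∘ a.e.symm =ᶠ[𝓝 z] (EuclideanSpace.proj (0 : Fin 3) : E3 →L[ℝ] ℝ) := by
    filter_upwards [a.e.open_target.mem_nhds hz] with y hy
    have := a.apply_zero _ (a.e.map_target hy)
    rw [a.e.right_inv hy] at this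
    exact this.symm
  rw [hid.mfderiv_eq, mfderiv_eq_fderiv, ContinuousLinearMap.fderiv] at hc
  exact (congrArg (fun L : E3 →L[ℝ] ℝ => L v) hc).symm

/-- The inverse of an adapted chart, as a parametrization of an open subset of `M`. -/
noncomputable def patch : Patch 3 (univ : Set M) where
  dom := a.e.target
  isOpen_dom := a.e.open_target
  map := a.e.symm
  smooth := a.smooth_symm
  injOn := a.e.symm.injOn
  immersion _ hz := a.dsymm_injective hz
  mapsTo _ _ := mem_univ _

theorem mfderiv_symm_comp_slice {t : ℝ} {y : E2} (hy : slice t y ∈ a.e.target) :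
    mfderiv (𝓡 2) (𝓡 3) (fun y => a.e.symm (slice t y)) y =
      (a.dsymm (slice t y)).comp planeIncl := by
  have h := mfderiv_comp (I := 𝓡 2) (I' := 𝓘(ℝ, E3)) (I'' := 𝓡 3) y
    (a.symm_mdifferentiableAt hy)
    (hasFDerivAt_slice t y).differentiableAt.mdifferentiableAt
  rw [mfderiv_eq_fderiv, (hasFDerivAt_slice t y).fderiv] at h
  exact h

/-- The parametrization of a level set of `Φ` given by the inverse of an adapted chart. -/
noncomputable def levelPatch (t : ℝ) : Patch 2 (Φ ⁻¹' {t}) where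
  dom := slice t ⁻¹' a.e.target
  isOpen_dom := a.e.open_target.preimage (contDiff_slice t).continuous
  map y := a.e.symm (slice t y)
  smooth := a.smooth_symm.comp ((contDiff_slice t).contMDiff.contMDiffOn) fun _ h => h
  injOn y hy y' hy' h := by
    rw [← planeProj_slice t y, ← planeProj_slice t y', a.e.symm.injOn hy hy' h]
  immersion y hy := by
    rw [a.mfderiv_symm_comp_slice hy]
    exact (a.dsymm_injective hy).comp planeIncl_injective
  mapsTo y hy := by
    have := a.apply_zero _ (a.e.map_target hy)
    rw [a.e.right_inv hy, slice_zero] at this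
    exact this.symm

variable [MeasurableSpace M] [BorelSpace M]

theorem formMeasure_univ_restrict (α : DiffForm M 3) :
    (formMeasure α univ).restrict a.e.source = a.patch.measure α :=
  formMeasure_restrict_eq α a.patch a.e.open_source (fun _ hz => a.e.map_target hz) a.e a.smooth
    fun _ _ hp => ⟨a.e.map_source hp, a.e.left_inv hp⟩

theorem formMeasure_level_restrict (α : DiffForm M 2) (t : ℝ) :
    (formMeasure α (Φ ⁻¹' {t})).restrict a.e.source = (a.levelPatch t).measure α := by
  refine formMeasure_restrict_eq α (a.levelPatch t) a.e.open_source
    (fun _ hz => a.e.map_target hz) (fun p => planeProj (a.e p))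
    (planeProj.contDiff.contMDiff.comp_contMDiffOn a.smooth) fun p hp hpO => ?_
  have h : slice t (planeProj (a.e p)) = a.e p := by
    have ht : t = a.e p 0 := by rw [a.apply_zero p hpO]; exact hp.symm
    rw [ht, slice_planeProj]
  refine ⟨?_, ?_⟩
  · change slice t (planeProj (a.e p)) ∈ a.e.target
    rw [h]; exact a.e.map_source hpO
  · change a.e.symm (slice t (planeProj (a.e p))) = p
    rw [h, a.e.left_inv hpO]

end AdaptedChart

theorem Patch.lintegral_measure [MeasurableSpace M] [BorelSpace M] {k : ℕ} {S : Set M}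
    (P : Patch k S) (α : DiffForm M k) (hα : ContinuousOn (P.density α) P.dom)
    {h : M → ℝ≥0∞} (hh : Measurable h) :
    ∫⁻ p, h p ∂(P.measure α) =
      ∫⁻ u in P.dom, ENNReal.ofReal (P.density α u) * h (P.map u) := by
  have hP := P.smooth.continuousOn.aemeasurable (μ := volume) P.isOpen_dom.measurableSet
  have hm : AEMeasurable P.map ((volume.restrict P.dom).withDensity
      fun u => ENNReal.ofReal (P.density α u)) :=
    hP.mono_ac (withDensity_absolutelyContinuous _ _)
  rw [Patch.measure, lintegral_map' hh.aemeasurable hm]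
  exact lintegral_withDensity_eq_lintegral_mul₀
    (hα.aemeasurable P.isOpen_dom.measurableSet).ennreal_ofReal (hh.comp_aemeasurable hP)

variable [IsManifold (𝓡 3) ∞ M]

/-- Smoothness of `V` is given in the charts of the atlas. The adapted density is the atlas density
times the Jacobian determinant of the transition map. -/
theorem AdaptedChart.continuousOn_density {Φ : M → ℝ} {x₀ : M} (a : AdaptedChart Φ x₀)
    (V : VolumeForm M) : ContinuousOn (a.patch.density V.form) a.e.target := by
  set φ := extChartAt (𝓡 3) x₀ with hφ
  have hT : IsOpen φ.target := isOpen_extChartAt_target x₀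
  have hmaps : ∀ z ∈ a.e.target, a.e.symm z ∈ φ.source := fun z hz =>
    a.source_subset (a.e.map_target hz)
  let Q : Patch 3 (univ : Set M) :=
    { dom := φ.target
      isOpen_dom := hT
      map := φ.symm
      smooth := contMDiffOn_extChartAt_symm x₀
      injOn := φ.symm.injOn
      immersion := fun y hy => by
        have := chartPush_injective (x₀ := x₀) (φ.map_target hy)
        unfold chartPush at this
        rwa [← hφ, φ.right_inv hy] at this
      mapsTo := fun _ _ => mem_univ _ }
  have hQ : ContinuousOn (Q.density V.form) φ.target := by
    have h1 : ContinuousOn (V.form.inChart x₀) φ.target := by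
      have := (V.smooth x₀).continuousOn
      rwa [preimage_univ, inter_univ] at this
    exact ((ContinuousAlternatingMap.apply ℝ E3 ℝ
      (fun i => EuclideanSpace.single i 1)).continuous.comp_continuousOn h1).abs
  have hτ : ContDiffOn ℝ ∞ (φ ∘ a.e.symm) a.e.target :=
    contMDiffOn_iff_contDiffOn.1 ((contMDiffOn_extChartAt (I := 𝓡 3) (n := ∞) (x := x₀)).comp
      a.smooth_symm (fun z hz => by simpa [hφ] using hmaps z hz))
  have hdet : ContinuousOn (fun z => |(fderiv ℝ (φ ∘ a.e.symm) z).det|) a.e.target :=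
    (ContinuousLinearMap.continuous_det.comp_continuousOn
      (hτ.continuousOn_fderiv_of_isOpen a.e.open_target (by simp))).abs
  refine (hdet.mul (hQ.comp hτ.continuousOn fun z hz => φ.map_source (hmaps z hz))).congr
    fun z hz => ?_
  refine a.patch.density_eq_det_mul Q V.form (φ.map_source (hmaps z hz))
    ((hτ.contDiffAt (a.e.open_target.mem_nhds hz)).differentiableAt (by simp)) ?_
  filter_upwards [a.e.open_target.mem_nhds hz] with y hy
  exact (φ.left_inv (hmaps y hy)).symm

theorem ContactStructure.mfderiv_unitNormal (C : ContactStructure M) {Φ : M → ℝ} {p : M}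
    (h : C.norm p (C.horizontalGradient Φ p) ≠ 0) :
    mfderiv (𝓡 3) 𝓘(ℝ, ℝ) Φ p (C.unitNormal Φ p) =
      C.norm p (C.horizontalGradient Φ p) := by
  rw [ContactStructure.unitNormal, ← C.horizontalGradient_spec Φ p, map_smul, smul_eq_mul]
  have hpos : 0 ≤ C.g p (C.horizontalGradient Φ p) (C.horizontalGradient Φ p) := by
    by_contra hneg
    exact h (Real.sqrt_eq_zero_of_nonpos (not_le.1 hneg).le)
  have := Real.mul_self_sqrt hpos
  change C.norm p _ * C.norm p _ = _ at this
  rw [← this, inv_mul_cancel_left₀ h]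

/-- This is the source of the weight: in adapted coordinates the zeroth component of the unit normal
is `dΦ(ν) = ‖∇_H Φ‖`, and the other components do not affect `ι_ν V` on a slice. -/
theorem AdaptedChart.density_areaForm {Φ : M → ℝ} {x₀ : M} (a : AdaptedChart Φ x₀)
    (hΦ : ContMDiff (𝓡 3) 𝓘(ℝ, ℝ) ∞ Φ) (C : ContactStructure M) (V : VolumeForm M)
    (h0 : ∀ p : M, C.norm p (C.horizontalGradient Φ p) ≠ 0) {t : ℝ} {y : E2}
    (hy : slice t y ∈ a.e.target) :
    (a.levelPatch t).density (areaForm C V Φ) y =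
      C.norm _ (C.horizontalGradient Φ (a.e.symm (slice t y))) *
        a.patch.density V.form (slice t y) := by
  set z := slice t y with hz
  set p := a.e.symm z with hp
  obtain ⟨n, hn⟩ := a.dsymm_surjective hy (C.unitNormal Φ p)
  have hn0 : n 0 = C.norm p (C.horizontalGradient Φ p) := by
    rw [← C.mfderiv_unitNormal (h0 p), ← hn]
    exact (a.mfderiv_dsymm hΦ hy n).symm
  have h1 := alternating_map_vecCons ((V.form p).compContinuousLinearMap (a.dsymm z)) n
  have hw : 0 ≤ C.norm p (C.horizontalGradient Φ p) := Real.sqrt_nonneg _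
  have hL : (a.levelPatch t).density (areaForm C V Φ) y =
      |(V.form p) (fun i => a.dsymm z
        ((Matrix.vecCons n fun i : Fin 2 => EuclideanSpace.single i.succ 1 : Fin 3 → E3) i))| := by
    unfold Patch.density areaForm DiffForm.interior
    change |(V.form p) (Matrix.vecCons (C.unitNormal Φ p) fun i : Fin 2 =>
      mfderiv (𝓡 2) (𝓡 3) (fun y => a.e.symm (slice t y)) y (EuclideanSpace.single i 1))| = _
    congr 2
    ext1 i
    refine Fin.cases ?_ (fun j => ?_) i
    · exact hn.symm
    · rw [a.mfderiv_symm_comp_slice hy]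
      change a.dsymm z (planeIncl (EuclideanSpace.single j 1)) =
        a.dsymm z (EuclideanSpace.single j.succ 1)
      rw [planeIncl_single]
  rw [hL, ← abs_of_nonneg hw, ← hn0, Patch.density, ← abs_mul]
  exact congrArg abs h1

variable [MeasurableSpace M] [BorelSpace M]

/-- The coarea formula inside an adapted chart. -/
theorem AdaptedChart.coarea {Φ : M → ℝ} {x₀ : M} (a : AdaptedChart Φ x₀)
    (hΦ : ContMDiff (𝓡 3) 𝓘(ℝ, ℝ) ∞ Φ) (C : ContactStructure M) (V : VolumeForm M)
    (h0 : ∀ p : M, C.norm p (C.horizontalGradient Φ p) ≠ 0) {h : M → ℝ≥0∞} (hh : Measurable h)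
    {B : Set M} (hB : MeasurableSet B) (hBs : B ⊆ a.e.source) :
    AEMeasurable (fun t : ℝ => ∫⁻ p in B, h p ∂(areaMeasure C V Φ t)) volume ∧
    ∫⁻ p in B, h p * ENNReal.ofReal (C.norm p (C.horizontalGradient Φ p))
        ∂(formMeasure V.form univ) =
      ∫⁻ t : ℝ, ∫⁻ p in B, h p ∂(areaMeasure C V Φ t) := by
  set w : M → ℝ := fun p => C.norm p (C.horizontalGradient Φ p) with hw
  have hwc : Continuous w := C.continuous_norm_horizontalGradient hΦ
  have hloc : ∀ (ν : Measure M) (k : M → ℝ≥0∞),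
      ∫⁻ p in B, k p ∂ν = ∫⁻ p, B.indicator k p ∂(ν.restrict a.e.source) := fun ν k => by
    rw [lintegral_indicator hB, Measure.restrict_restrict hB, inter_eq_left.2 hBs]
  -- The common integrand: its integral over `ℝ³` is the left side, and its integral over the slice
  -- at `t` is the area integral on the level `t`.
  let K : E3 → ℝ≥0∞ := a.e.target.indicator fun z =>
    ENNReal.ofReal (a.patch.density V.form z) *
      B.indicator (fun p => h p * ENNReal.ofReal (w p)) (a.e.symm z)
  have hVc := a.continuousOn_density V
  have hkm : Measurable (B.indicator (fun p => h p * ENNReal.ofReal (w p))) :=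
    (hh.mul hwc.measurable.ennreal_ofReal).indicator hB
  have hsymm := a.smooth_symm.continuousOn.aemeasurable (μ := volume) a.e.open_target.measurableSet
  have hK : AEMeasurable K volume :=
    (aemeasurable_indicator_iff a.e.open_target.measurableSet).2
      ((hVc.aemeasurable a.e.open_target.measurableSet).ennreal_ofReal.mul
        (hkm.comp_aemeasurable hsymm))
  have hKs : AEMeasurable (fun p : ℝ × E2 => K (slice p.1 p.2)) (volume.prod volume) :=
    hK.comp_quasiMeasurePreserving measurePreserving_slice.quasiMeasurePreserving
  have hlevel : ∀ t : ℝ, ∫⁻ p in B, h p ∂(areaMeasure C V Φ t) = ∫⁻ y : E2, K (slice t y) := by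
    intro t
    have hdens : ContinuousOn ((a.levelPatch t).density (areaForm C V Φ))
        (a.levelPatch t).dom := by
      have h1 : ContinuousOn (fun y => w (a.e.symm (slice t y)) *
          a.patch.density V.form (slice t y)) (a.levelPatch t).dom :=
        (hwc.comp_continuousOn (a.levelPatch t).smooth.continuousOn).mul
          (hVc.comp (contDiff_slice t).continuous.continuousOn fun _ hy => hy)
      exact h1.congr fun y hy => a.density_areaForm hΦ C V h0 hy
    rw [hloc, areaMeasure, a.formMeasure_level_restrict,
      (a.levelPatch t).lintegral_measure _ hdens (hh.indicator hB),
      ← lintegral_indicator (a.levelPatch t).isOpen_dom.measurableSet]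
    refine lintegral_congr fun y => ?_
    by_cases hy : slice t y ∈ a.e.target
    · rw [indicator_of_mem (show y ∈ (a.levelPatch t).dom from hy)]
      simp only [K]
      rw [indicator_of_mem hy, a.density_areaForm hΦ C V h0 hy]
      change _ * B.indicator h (a.e.symm (slice t y)) = _
      by_cases hyB : a.e.symm (slice t y) ∈ B
      · rw [indicator_of_mem hyB, indicator_of_mem hyB, ENNReal.ofReal_mul
          (show 0 ≤ C.norm _ _ from Real.sqrt_nonneg _)]
        simp only [hw]
        ring
      · rw [indicator_of_notMem hyB, indicator_of_notMem hyB, mul_zero, mul_zero]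
    · rw [indicator_of_notMem (show y ∉ (a.levelPatch t).dom from hy)]
      simp only [K]
      rw [indicator_of_notMem hy]
  simp only [hlevel]
  refine ⟨hKs.lintegral_prod_right', ?_⟩
  -- Tonelli joins the slice integrals into one over `ℝ × ℝ²`, which `slice` carries to `ℝ³`
  -- preserving volume.
  rw [hloc, a.formMeasure_univ_restrict, a.patch.lintegral_measure _ hVc hkm,
    ← lintegral_prod _ hKs]
  have hmp := measurePreserving_slice
  rw [← hmp.map_eq] at hK
  have h1 := lintegral_map' hK hmp.measurable.aemeasurable
  rw [hmp.map_eq] at h1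
  refine Eq.trans ?_ h1
  exact (lintegral_indicator a.e.open_target.measurableSet _).symm

/-- The coarea formula for nonnegative Borel functions. -/
theorem coarea_of_measurable [SecondCountableTopology M] {Φ : M → ℝ}
    (hΦ : ContMDiff (𝓡 3) 𝓘(ℝ, ℝ) ∞ Φ) (C : ContactStructure M) (V : VolumeForm M)
    (h0 : ∀ p : M, C.norm p (C.horizontalGradient Φ p) ≠ 0) {h : M → ℝ≥0∞} (hh : Measurable h) :
    AEMeasurable (fun t : ℝ => ∫⁻ p, h p ∂(areaMeasure C V Φ t)) volume ∧
    ∫⁻ p, h p * ENNReal.ofReal (C.norm p (C.horizontalGradient Φ p)) ∂(formMeasure V.form univ) =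
      ∫⁻ t : ℝ, ∫⁻ p, h p ∂(areaMeasure C V Φ t) := by
  -- The countable cover is enumerated by `ℕ` below, which requires it to be nonempty.
  rcases isEmpty_or_nonempty M with hM | hM
  · simp [Measure.eq_zero_of_isEmpty]
  have hd : ∀ p : M, mfderiv (𝓡 3) 𝓘(ℝ, ℝ) Φ p ≠ 0 := fun p hp => by
    have := C.mfderiv_unitNormal (h0 p)
    rw [hp] at this
    exact h0 p this.symm
  let a : ∀ x : M, AdaptedChart Φ x := fun x => (exists_adaptedChart hΦ (hd x)).some
  obtain ⟨s, hs, hcover⟩ := TopologicalSpace.countable_cover_nhds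
    fun x => (a x).e.open_source.mem_nhds (a x).mem_source
  have hsne : s.Nonempty := by
    by_contra hne
    rw [not_nonempty_iff_eq_empty] at hne
    rw [hne, biUnion_empty] at hcover
    exact empty_ne_univ hcover
  obtain ⟨x, rfl⟩ := hs.exists_eq_range hsne
  let O : ℕ → Set M := fun n => (a (x n)).e.source
  have hO : ∀ n, MeasurableSet (O n) := fun n => (a (x n)).e.open_source.measurableSet
  have hB : ∀ n, MeasurableSet (disjointed O n) := fun n => MeasurableSet.disjointed hO n
  have hU : ⋃ n, disjointed O n = univ := by
    rw [iUnion_disjointed, ← hcover, biUnion_range]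
  -- The disjoint pieces depend neither on `t` nor on the measure, so one decomposition serves both
  -- sides of the formula.
  have hsplit : ∀ (ν : Measure M) (k : M → ℝ≥0∞),
      ∫⁻ p, k p ∂ν = ∑' n, ∫⁻ p in disjointed O n, k p ∂ν := fun ν k => by
    rw [← lintegral_iUnion hB (disjoint_disjointed O), hU, Measure.restrict_univ]
  have hloc := fun n => (a (x n)).coarea hΦ C V h0 hh (hB n) (disjointed_subset O n)
  rw [funext fun t => hsplit (areaMeasure C V Φ t) h, hsplit]
  refine ⟨AEMeasurable.tsum fun n => (hloc n).1, ?_⟩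
  rw [lintegral_tsum fun n => (hloc n).1]
  exact tsum_congr fun n => (hloc n).2

end Coarea

end SubRiem

/-! ### From Borel functions to `μ`-measurable ones -/

theorem mainTheorem5 {M : Type*} [TopologicalSpace M] [ChartedSpace SubRiem.E3 M]
    [IsManifold (𝓡 3) ∞ M] [T2Space M] [SecondCountableTopology M]
    [MeasurableSpace M] [BorelSpace M]
    (C : SubRiem.ContactStructure M) (V : SubRiem.VolumeForm M) (μ : Measure M)
    (hμ : SubRiem.IsSmoothMeasure μ V)
    (Φ : M → ℝ) (hΦ : ContMDiff (𝓡 3) 𝓘(ℝ, ℝ) ∞ Φ)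
    (hΦ0 : ∀ p : M, C.norm p (C.horizontalGradient Φ p) ≠ 0)
    (f : M → ℝ) (hf : AEMeasurable f μ) (hf0 : ∀ p : M, 0 ≤ f p) :
    (∀ᵐ t : ℝ, AEMeasurable f (SubRiem.areaMeasure C V Φ t)) ∧
    AEMeasurable (fun t : ℝ => ∫⁻ p, ENNReal.ofReal (f p) ∂(SubRiem.areaMeasure C V Φ t)) volume ∧
    ∫⁻ p, ENNReal.ofReal (f p * C.norm p (C.horizontalGradient Φ p)) ∂μ =
      ∫⁻ t : ℝ, ∫⁻ p, ENNReal.ofReal (f p) ∂(SubRiem.areaMeasure C V Φ t) := by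
  obtain ⟨f', hf', hff'⟩ := hf
  obtain ⟨Z, hZsub, hZ, hZ0⟩ := exists_measurable_superset_of_null (ae_iff.1 hff')
  -- The Borel formula for the indicator of the `μ`-null set `Z` has left side zero, so `Z` has zero
  -- area on almost every level; off `Z`, `f` equals its Borel representative `f'`.
  have hae : ∀ᵐ t : ℝ, f =ᵐ[SubRiem.areaMeasure C V Φ t] f' := by
    have hnull := SubRiem.coarea_of_measurable hΦ C V hΦ0
      (h := Z.indicator 1) (measurable_one.indicator hZ)
    have hleft : ∫⁻ p, Z.indicator 1 p * ENNReal.ofReal (C.norm p (C.horizontalGradient Φ p))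
        ∂(SubRiem.formMeasure V.form Set.univ) = 0 := by
      rw [← hμ]
      refine (lintegral_congr_ae ?_).trans lintegral_zero
      filter_upwards [measure_eq_zero_iff_ae_notMem.1 hZ0] with p hp
      rw [Set.indicator_of_notMem hp, zero_mul]
    have hright := hnull.2.symm.trans hleft
    rw [lintegral_eq_zero_iff' hnull.1] at hright
    filter_upwards [hright] with t ht
    rw [lintegral_indicator_one hZ] at ht
    exact ae_iff.2 (measure_mono_null hZsub ht)
  have hint : ∀ᵐ t : ℝ, ∫⁻ p, ENNReal.ofReal (f' p) ∂(SubRiem.areaMeasure C V Φ t) =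
      ∫⁻ p, ENNReal.ofReal (f p) ∂(SubRiem.areaMeasure C V Φ t) := by
    filter_upwards [hae] with t ht
    refine lintegral_congr_ae ?_
    filter_upwards [ht] with p hp
    rw [hp]
  obtain ⟨hm, heq⟩ := SubRiem.coarea_of_measurable hΦ C V hΦ0 hf'.ennreal_ofReal
  refine ⟨?_, hm.congr hint, ?_⟩
  · filter_upwards [hae] with t ht using ⟨f', hf', ht⟩
  · rw [← lintegral_congr_ae hint, ← heq, ← hμ]
    refine lintegral_congr_ae ?_
    filter_upwards [hff'] with p hp
    rw [ENNReal.ofReal_mul (hf0 p), hp]
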